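/- Let $(\mathcal H,[\cdot,\cdot])$ be a complex Krein space, i.e. a complex vector space with a Hermitian sesquilinear form that admits a fundamental decomposition $\mathcal H=\mathcal H_+\,[\dotplus]\,\mathcal H_-$: a direct sum of two $[\cdot,\cdot]$-orthogonal subspaces such that $(\mathcal H_+,[\cdot,\cdot])$ and $(\mathcal H_-,-[\cdot,\cdot])$ are Hilbert spaces. The signature operator of such a decomposition is $J=P_+-P_-$, where $P_\pm$ is the projection onto $\mathcal H_\pm$ along $\mathcal H_\mp$; the associated Hilbert space is $\mathcal H$ with $\langle x,y\rangle_J=[Jx,y]$. All associated Hilbert space norms are equivalent, and "bounded" and "closed" refer to any of them. For a Hilbert space, a closed subspace $\mathcal S$ and a bounded selfadjoint operator $B=\begin{bmatrix} a & b\\ b^* & c\end{bmatrix}$ with respect to $\mathcal S\oplus\mathcal S^\perp$, the operator $B$ is called $\mathcal S$-weakly complementable if $R(b)\subseteq R(|a|^{1/2})$. In this case its Schur complement to $\mathcal S$ is $$B_{/\mathcal S}=\begin{bmatrix} 0&0\\ 0& c-f^*uf\end{bmatrix},$$ where $a=u|a|$ is the polar decomposition of $a$ ($u$ a partial isometry with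 $N(u)=N(a)$) and $f$ is the reduced solution of $b=|a|^{1/2}x$, i.e. the unique bounded $f$ with $b=|a|^{1/2}f$, $N(f)=N(b)$ and $R(f)\subseteq\overline{R(|a|^{1/2})}$. Let $W$ be a bounded operator on $\mathcal H$ that is selfadjoint for $[\cdot,\cdot]$, i.e. $[Wx,y]=[x,Wy]$ for all $x,y$, and let $\mathcal S$ be a closed subspace of $\mathcal H$. Suppose that $W$ is $\mathcal S$-weakly complementable, i.e. for some signature operator $J_0$ the operator $J_0W$ is $\mathcal S$-weakly complementable in $(\mathcal H,\langle\cdot,\cdot\rangle_{J_0})$. Then, for every signature operator $J$, the operator $JW$ is $\mathcal S$-weakly complementable in $(\mathcal H,\langle\cdot,\cdot\rangle_J)$, and for any two signature operators $J$ and $J_\alpha$ $$J\,(JW)_{/\mathcal S}=J_\alpha\,(J_\alpha W)_{/\mathcal S},$$ where each Schur complement is taken in the Hilbert space associated with the respective signature operator. Hence there is exactly one operator $W_{/[\mathcal S]}$ on $\mathcal H$ with $W_{/[\mathcal S]}=J\,(JW)_{/\mathcal S}$ for every signature operator $J$. -/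

import Mathlib

section HilbertSpace

variable {H K L : Type*}
  [NormedAddCommGroup H] [InnerProductSpace ℂ H] [CompleteSpace H]
  [NormedAddCommGroup K] [InnerProductSpace ℂ K] [CompleteSpace K]
  [NormedAddCommGroup L] [InnerProductSpace ℂ L] [CompleteSpace L]

/-- `D` is the reduced solution of `Z = Y X`: `Z = Y D`, `N(D) = N(Z)` and
`R(D)` is contained in the closure of `R(Y*)`. -/
structure IsReducedSolution (Y : K →L[ℂ] H) (Z : L →L[ℂ] H) (D : L →L[ℂ] K) : Prop where
  comp_eq : Z = Y ∘L D
  ker_eq : D.ker = Z.ker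
  range_le : D.range ≤ (ContinuousLinearMap.adjoint Y).range.topologicalClosure

theorem exists_isReducedSolution (Y : K →L[ℂ] H) (Z : L →L[ℂ] H) (h : Z.range ≤ Y.range) :
    ∃ D : L →L[ℂ] K, IsReducedSolution Y Z D := by
  obtain ⟨g, hg⟩ := LinearMap.exists_rightInverse_of_surjective
    (Y : K →ₗ[ℂ] H).rangeRestrict (LinearMap.range_rangeRestrict _)
  have hcl : IsClosed (Y.ker : Set K) := Y.isClosed_ker
  have hproj (v : K) : Y (Y.kerᗮ.starProjection v) = Y v := by
    have h1 := Y.ker.starProjection_add_starProjection_orthogonal v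
    have h2 : Y (Y.ker.starProjection v) = 0 := Y.ker.starProjection_apply_mem v
    conv_rhs => rw [← h1, map_add, h2, zero_add]
  let D : L →ₗ[ℂ] K := (Y.kerᗮ.starProjection : K →ₗ[ℂ] K) ∘ₗ g ∘ₗ
    (Z : L →ₗ[ℂ] H).codRestrict Y.range (fun x => h ⟨x, rfl⟩)
  have hYD (x : L) : Y (D x) = Z x := by
    have := congrArg Subtype.val (LinearMap.congr_fun hg
      ((Z : L →ₗ[ℂ] H).codRestrict Y.range (fun x => h ⟨x, rfl⟩) x))
    exact (hproj _).trans this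
  have hmem (x : L) : D x ∈ Y.kerᗮ := Submodule.starProjection_apply_mem _ _
  have huniq (v w : K) (hv : v ∈ Y.kerᗮ) (hw : w ∈ Y.kerᗮ) (hvw : Y v = Y w) : v = w := by
    rw [← sub_eq_zero]
    have h1 : v - w ∈ Y.ker := by simp [hvw]
    exact inner_self_eq_zero.mp
      (Submodule.inner_right_of_mem_orthogonal h1 (Submodule.sub_mem _ hv hw))
  have hcont : Continuous D := by
    refine D.continuous_of_seq_closed_graph fun u x y hu hDu => ?_
    refine huniq _ _ ?_ (hmem x) ?_
    · exact (Submodule.isClosed_orthogonal _).mem_of_tendsto hDu (.of_forall fun n => hmem _)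
    · have h1 : Filter.Tendsto (fun n => Y (D (u n))) Filter.atTop (nhds (Y y)) :=
        (Y.continuous.tendsto y).comp hDu
      simp only [hYD] at h1 ⊢
      exact tendsto_nhds_unique h1 ((Z.continuous.tendsto x).comp hu)
  refine ⟨⟨D, hcont⟩, ?_, ?_, ?_⟩
  · ext x; exact (hYD x).symm
  · ext x
    change D x = 0 ↔ Z x = 0
    constructor
    · intro hx; rw [← hYD, hx, map_zero]
    · intro hx
      exact huniq _ _ (hmem x) (Submodule.zero_mem _) (by rw [hYD, hx, map_zero])
  · rintro _ ⟨x, rfl⟩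
    rw [← Y.orthogonal_ker]
    exact hmem x

/-- The reduced solution of `Z = Y X`, for `R(Z) ⊆ R(Y)`. -/
noncomputable def reducedSolution (Y : K →L[ℂ] H) (Z : L →L[ℂ] H) (h : Z.range ≤ Y.range) :
    L →L[ℂ] K :=
  (exists_isReducedSolution Y Z h).choose

/-- `T = U |T|` is the polar decomposition of `T`: `U` is a partial isometry and `N(U) = N(T)`. -/
structure IsPolarFactor (T U : H →L[ℂ] H) : Prop where
  comp_abs : T = U ∘L CFC.abs T
  isometry_on : ∀ x ∈ U.kerᗮ, ‖U x‖ = ‖x‖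
  ker_eq : U.ker = T.ker

theorem exists_isPolarFactor (T : H →L[ℂ] H) : ∃ U : H →L[ℂ] H, IsPolarFactor T U := by
  set A : H →L[ℂ] H := CFC.abs T with hA
  have hAsa : ContinuousLinearMap.adjoint A = A :=
    (IsSelfAdjoint.of_nonneg (CFC.abs_nonneg T)).star_eq
  have hAA : ContinuousLinearMap.adjoint A ∘L A = ContinuousLinearMap.adjoint T ∘L T := by
    rw [hAsa]; exact CFC.abs_mul_abs T
  have hnorm (x : H) : ‖T x‖ = ‖A x‖ := by
    have h1 : ‖T x‖ ^ 2 = ‖A x‖ ^ 2 := by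
      rw [T.apply_norm_sq_eq_inner_adjoint_left, A.apply_norm_sq_eq_inner_adjoint_left, hAA]
    exact (sq_eq_sq₀ (norm_nonneg _) (norm_nonneg _)).mp h1
  have hker : A.ker = T.ker := by
    ext x
    change A x = 0 ↔ T x = 0
    rw [← norm_eq_zero, ← hnorm, norm_eq_zero]
  set R : Submodule ℂ H := A.kerᗮ with hR
  have hRA : R = A.range.topologicalClosure := by rw [hR, A.orthogonal_ker, hAsa]
  have hAR (x : H) : A x ∈ R := by
    rw [hRA]; exact Submodule.le_topologicalClosure _ ⟨x, rfl⟩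
  let e : H →ₗ[ℂ] R := (A : H →ₗ[ℂ] H).codRestrict R hAR
  have hdense : DenseRange e := by
    intro y
    rw [closure_subtype]
    have hy : (y : H) ∈ closure (A.range : Set H) := by
      exact hRA.le y.2
    convert hy using 2
    ext z
    constructor
    · rintro ⟨_, ⟨x, rfl⟩, rfl⟩; exact ⟨x, rfl⟩
    · rintro ⟨x, rfl⟩; exact ⟨e x, ⟨x, rfl⟩, rfl⟩
  have hb : ∀ x, ‖(T : H →ₗ[ℂ] H) x‖ ≤ 1 * ‖e x‖ := fun x => by
    rw [one_mul]; exact (hnorm x).le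
  let V : R →L[ℂ] H := (T : H →ₗ[ℂ] H).extendOfNorm e
  have hV (x : H) : V (e x) = T x := LinearMap.extendOfNorm_eq hdense ⟨1, hb⟩ x
  have hVn (y : R) : ‖V y‖ = ‖y‖ := by
    refine hdense.induction (P := fun y => ‖V y‖ = ‖y‖) ?_ (isClosed_eq (by fun_prop) (by fun_prop)) y
    rintro _ ⟨x, rfl⟩
    rw [hV]; exact hnorm x
  have hUker : (V ∘L R.orthogonalProjectionOnto).ker = T.ker := by
    have h2 : Rᗮ = A.ker := by
      have : CompleteSpace A.ker := A.isClosed_ker.completeSpace_coe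
      rw [hR, Submodule.orthogonal_orthogonal]
    rw [← hker]
    ext x
    rw [show x ∈ A.ker ↔ x ∈ Rᗮ from by rw [h2], ← Submodule.orthogonalProjectionOnto_eq_zero_iff]
    change V (R.orthogonalProjectionOnto x) = 0 ↔ _
    rw [← norm_eq_zero, hVn, norm_eq_zero]
  refine ⟨V ∘L R.orthogonalProjectionOnto, ?_, ?_, hUker⟩
  · ext x
    have : R.orthogonalProjectionOnto (A x) = e x :=
      Submodule.orthogonalProjectionOnto_mem_subspace_eq_self (e x)
    change T x = V (R.orthogonalProjectionOnto (A x))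
    rw [this, hV]
  · intro x hx
    rw [hUker, ← hker] at hx
    have : R.orthogonalProjectionOnto x = ⟨x, hx⟩ :=
      Submodule.orthogonalProjectionOnto_mem_subspace_eq_self (⟨x, hx⟩ : R)
    change ‖V (R.orthogonalProjectionOnto x)‖ = ‖x‖
    rw [this, hVn]; rfl

/-- The partial isometry `U` of the polar decomposition `T = U |T|`. -/
noncomputable def polarFactor (T : H →L[ℂ] H) : H →L[ℂ] H :=
  (exists_isPolarFactor T).choose

/-- `|T|^{1/2}`, where `|T| = (T* T)^{1/2}`. -/
noncomputable def modulusSqrt (T : H →L[ℂ] H) : H →L[ℂ] H :=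
  CFC.sqrt (CFC.abs T)

/-- The block `a : S → S` of `B` in the decomposition `S ⊕ Sᗮ`. -/
noncomputable def blockA (B : H →L[ℂ] H) (S : Submodule ℂ H) [CompleteSpace S] : S →L[ℂ] S :=
  S.orthogonalProjectionOnto ∘L B ∘L S.subtypeL

/-- The block `b : Sᗮ → S` of `B` in the decomposition `S ⊕ Sᗮ`. -/
noncomputable def blockB (B : H →L[ℂ] H) (S : Submodule ℂ H) [CompleteSpace S] : Sᗮ →L[ℂ] S :=
  S.orthogonalProjectionOnto ∘L B ∘L Sᗮ.subtypeL

/-- The block `c : Sᗮ → Sᗮ` of `B` in the decomposition `S ⊕ Sᗮ`. -/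
noncomputable def blockC (B : H →L[ℂ] H) (S : Submodule ℂ H) [CompleteSpace S] : Sᗮ →L[ℂ] Sᗮ :=
  Sᗮ.orthogonalProjectionOnto ∘L B ∘L Sᗮ.subtypeL

/-- `B` is `S`-weakly complementable in the Hilbert space `H`: `R(b) ⊆ R(|a|^{1/2})`. -/
def IsWeaklyComplementable (B : H →L[ℂ] H) (S : Submodule ℂ H) [CompleteSpace S] : Prop :=
  (blockB B S).range ≤ (modulusSqrt (blockA B S)).range

/-- The Schur complement of `B` to `S`: the operator with matrix `0 ⊕ (c - f* u f)` in the
decomposition `S ⊕ Sᗮ`, where `f` is the reduced solution of `b = |a|^{1/2} x` and `a = u |a|` is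
the polar decomposition of `a`. -/
noncomputable def schurComplement (B : H →L[ℂ] H) (S : Submodule ℂ H) [CompleteSpace S]
    (h : IsWeaklyComplementable B S) : H →L[ℂ] H :=
  let f : Sᗮ →L[ℂ] S := reducedSolution (modulusSqrt (blockA B S)) (blockB B S) h
  let u : S →L[ℂ] S := polarFactor (blockA B S)
  Sᗮ.subtypeL ∘L (blockC B S - ContinuousLinearMap.adjoint f ∘L u ∘L f) ∘L
    Sᗮ.orthogonalProjectionOnto

end HilbertSpace

section KreinSpace

variable {H : Type*} [AddCommGroup H] [Module ℂ H]

/-- `(V, g)` is a Hilbert space: `g` is an inner product (conjugate-linear in the first variable)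
and `V` is complete for the induced norm. -/
def IsHilbertForm {V : Type*} [AddCommGroup V] [Module ℂ V] (g : V →ₗ⋆[ℂ] V →ₗ[ℂ] ℂ) : Prop :=
  ∃ c : InnerProductSpace.Core ℂ V, (∀ x y, c.inner x y = g x y) ∧
    @CompleteSpace V c.toNormedAddCommGroup.toUniformSpace

/-- An indefinite metric on `H`: a Hermitian sesquilinear form `[·, ·]`, conjugate-linear in the
first variable. -/
structure IndefiniteMetric (H : Type*) [AddCommGroup H] [Module ℂ H] where
  form : H →ₗ⋆[ℂ] H →ₗ[ℂ] ℂ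
  isSymm : form.IsSymm

/-- A fundamental decomposition `H = H₊ [∔] H₋`, with `(H₊, [·, ·])` and `(H₋, -[·, ·])` Hilbert
spaces. -/
structure FundamentalDecomposition (M : IndefiniteMetric H) where
  pos : Submodule ℂ H
  neg : Submodule ℂ H
  isCompl : IsCompl pos neg
  orthogonal : ∀ x ∈ pos, ∀ y ∈ neg, M.form x y = 0
  hilbert_pos : IsHilbertForm (M.form.domRestrict₁₂ pos pos)
  hilbert_neg : IsHilbertForm (-(M.form.domRestrict₁₂ neg neg))

/-- `(H, [·, ·])` is a Krein space: it admits a fundamental decomposition. -/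
def IndefiniteMetric.IsKrein (M : IndefiniteMetric H) : Prop :=
  Nonempty (FundamentalDecomposition M)

namespace FundamentalDecomposition

variable {M : IndefiniteMetric H} (D : FundamentalDecomposition M)

/-- The signature operator `J = P₊ - P₋` of a fundamental decomposition. -/
noncomputable def signature : H →ₗ[ℂ] H :=
  D.pos.projection D.neg D.isCompl - D.neg.projection D.pos D.isCompl.symm

/-- The inner product `⟨x, y⟩ = [J x, y]` in terms of the components of `x` and `y`. -/
theorem form_signature (x y : H) :
    M.form (D.signature x) y =
      M.form (D.pos.projectionOnto D.neg D.isCompl x) (D.pos.projectionOnto D.neg D.isCompl y)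
      - M.form (D.neg.projectionOnto D.pos D.isCompl.symm x)
          (D.neg.projectionOnto D.pos D.isCompl.symm y) := by
  set p := D.pos.projectionOnto D.neg D.isCompl
  set n := D.neg.projectionOnto D.pos D.isCompl.symm
  have hy : (p y : H) + n y = y := Submodule.projection_add_projection_eq_self D.isCompl y
  have hJ : D.signature x = (p x : H) - n x := rfl
  have h1 : M.form (p x) (n y) = 0 := D.orthogonal _ (p x).2 _ (n y).2
  have h2 : M.form (n x) (p y) = 0 :=
    M.isSymm.isRefl _ _ (D.orthogonal _ (p y).2 _ (n x).2)
  conv_lhs => rw [hJ, ← hy]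
  simp only [map_sub, map_add, LinearMap.sub_apply, h1, h2]
  ring

/-- The inner product `⟨x, y⟩ = [J x, y]`. -/
@[reducible]
noncomputable def core : InnerProductSpace.Core ℂ H where
  inner x y := M.form (D.signature x) y
  conj_inner_symm x y := by
    simp only [form_signature, map_sub]
    congr 1 <;> exact M.isSymm.eq _ _
  re_inner_nonneg x := by
    obtain ⟨cp, hcp, -⟩ := D.hilbert_pos
    obtain ⟨cn, hcn, -⟩ := D.hilbert_neg
    have h1 := cp.re_inner_nonneg (D.pos.projectionOnto D.neg D.isCompl x)
    have h2 := cn.re_inner_nonneg (D.neg.projectionOnto D.pos D.isCompl.symm x)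
    rw [hcp] at h1
    rw [hcn] at h2
    simp only [LinearMap.neg_apply, LinearMap.domRestrict₁₂_apply, map_neg] at h1 h2
    rw [form_signature, map_sub]
    linarith
  add_left x y z := by simp
  smul_left x y r := by simp
  definite x hx := by
    obtain ⟨cp, hcp, -⟩ := D.hilbert_pos
    obtain ⟨cn, hcn, -⟩ := D.hilbert_neg
    have h1 := cp.re_inner_nonneg (D.pos.projectionOnto D.neg D.isCompl x)
    have h2 := cn.re_inner_nonneg (D.neg.projectionOnto D.pos D.isCompl.symm x)
    have h3 := cp.definite (D.pos.projectionOnto D.neg D.isCompl x)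
    have h4 := cn.definite (D.neg.projectionOnto D.pos D.isCompl.symm x)
    have s1 := cp.conj_inner_symm (D.pos.projectionOnto D.neg D.isCompl x)
      (D.pos.projectionOnto D.neg D.isCompl x)
    have s2 := cn.conj_inner_symm (D.neg.projectionOnto D.pos D.isCompl.symm x)
      (D.neg.projectionOnto D.pos D.isCompl.symm x)
    rw [hcp] at h1 h3 s1
    rw [hcn] at h2 h4 s2
    simp only [LinearMap.neg_apply, LinearMap.domRestrict₁₂_apply, map_neg, neg_eq_zero,
      neg_inj] at h1 h2 h3 h4 s1 s2
    rw [form_signature] at hx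
    rw [Complex.conj_eq_iff_im] at s1 s2
    have hre := congrArg Complex.re hx
    simp only [Complex.sub_re, Complex.zero_re] at hre
    simp only [RCLike.re_to_complex] at h1 h2
    have e1 := h3 (Complex.ext (by simp only [Complex.zero_re]; linarith) s1)
    have e2 := h4 (Complex.ext (by simp only [Complex.zero_re]; linarith) s2)
    rw [← Submodule.projection_add_projection_eq_self D.isCompl x, Submodule.projection_apply,
      Submodule.projection_apply, e1, e2]
    simp

/-- A copy of `H`, carrying the Hilbert space structure `⟨x, y⟩ = [J x, y]` that is associated with
the fundamental decomposition `D`. -/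
@[nolint unusedArguments]
def Space (_D : FundamentalDecomposition M) : Type _ := H

noncomputable instance : NormedAddCommGroup D.Space :=
  D.core.toNormedAddCommGroup

noncomputable instance : InnerProductSpace ℂ D.Space :=
  InnerProductSpace.ofCore D.core.toCore

/-- The identity map from `H` to its copy with the Hilbert space structure of `D`. -/
noncomputable def toSpace : H ≃ₗ[ℂ] D.Space where
  toFun x := x
  invFun x := x
  map_add' _ _ := rfl
  map_smul' _ _ := rfl
  left_inv _ := rfl
  right_inv _ := rfl

theorem inner_toSpace (x y : H) :
    inner ℂ (D.toSpace x) (D.toSpace y) = M.form (D.signature x) y := rfl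

theorem norm_toSpace_sq (x : H) :
    ‖D.toSpace x‖ ^ 2 = (M.form (D.signature x) x).re :=
  norm_sq_eq_re_inner (𝕜 := ℂ) (D.toSpace x)

instance : CompleteSpace D.Space := by
  obtain ⟨cp, hcp, hp⟩ := D.hilbert_pos
  obtain ⟨cn, hcn, hn⟩ := D.hilbert_neg
  let : NormedAddCommGroup D.pos := cp.toNormedAddCommGroup
  let : NormedAddCommGroup D.neg := cn.toNormedAddCommGroup
  let : InnerProductSpace ℂ D.pos := InnerProductSpace.ofCore cp.toCore
  let : InnerProductSpace ℂ D.neg := InnerProductSpace.ofCore cn.toCore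
  have hnp (x : D.pos) : ‖x‖ ^ 2 = (M.form x x).re := by
    rw [norm_sq_eq_re_inner (𝕜 := ℂ) x]; exact congrArg Complex.re (hcp x x)
  have hnn (x : D.neg) : ‖x‖ ^ 2 = -(M.form x x).re := by
    rw [norm_sq_eq_re_inner (𝕜 := ℂ) x]; exact congrArg Complex.re (hcn x x)
  set p := D.pos.projectionOnto D.neg D.isCompl with hpd
  set n := D.neg.projectionOnto D.pos D.isCompl.symm with hnd
  have hsq (x : H) : ‖D.toSpace x‖ ^ 2 = ‖p x‖ ^ 2 + ‖n x‖ ^ 2 := by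
    rw [norm_toSpace_sq, form_signature, Complex.sub_re, hnp, hnn, sub_eq_add_neg]
  have hple (x : H) : ‖p x‖ ≤ ‖D.toSpace x‖ := by
    refine (sq_le_sq₀ (norm_nonneg _) (norm_nonneg _)).mp ?_
    rw [hsq]; nlinarith [sq_nonneg ‖n x‖]
  have hnle (x : H) : ‖n x‖ ≤ ‖D.toSpace x‖ := by
    refine (sq_le_sq₀ (norm_nonneg _) (norm_nonneg _)).mp ?_
    rw [hsq]; nlinarith [sq_nonneg ‖p x‖]
  refine Metric.complete_of_cauchySeq_tendsto fun u hu => ?_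
  have hup : CauchySeq (fun k => p (D.toSpace.symm (u k))) := by
    rw [Metric.cauchySeq_iff] at hu ⊢
    intro ε hε
    obtain ⟨N, hN⟩ := hu ε hε
    refine ⟨N, fun m hm k hk => lt_of_le_of_lt ?_ (hN m hm k hk)⟩
    rw [dist_eq_norm, dist_eq_norm, ← map_sub, ← map_sub]
    simpa using hple (D.toSpace.symm (u m - u k))
  have hun : CauchySeq (fun k => n (D.toSpace.symm (u k))) := by
    rw [Metric.cauchySeq_iff] at hu ⊢
    intro ε hε
    obtain ⟨N, hN⟩ := hu ε hε
    refine ⟨N, fun m hm k hk => lt_of_le_of_lt ?_ (hN m hm k hk)⟩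
    rw [dist_eq_norm, dist_eq_norm, ← map_sub, ← map_sub]
    simpa using hnle (D.toSpace.symm (u m - u k))
  obtain ⟨a, ha⟩ := cauchySeq_tendsto_of_complete hup
  obtain ⟨b, hb⟩ := cauchySeq_tendsto_of_complete hun
  refine ⟨D.toSpace (a + b), ?_⟩
  rw [tendsto_iff_norm_sub_tendsto_zero] at ha hb ⊢
  have hpab : p ((a : H) + b) = a := by simp [hpd]
  have hnab : n ((a : H) + b) = b := by simp [hnd]
  have hlim := ((ha.pow 2).add (hb.pow 2)).sqrt
  simp only [ne_eq, OfNat.ofNat_ne_zero, not_false_eq_true, zero_pow, add_zero,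
    Real.sqrt_zero] at hlim
  refine hlim.congr fun k => ?_
  rw [← Real.sqrt_sq (norm_nonneg (u k - D.toSpace ((a : H) + b)))]
  have h1 := hsq (D.toSpace.symm (u k) - (a + b))
  rw [map_sub p, map_sub n, hpab, hnab, map_sub D.toSpace, LinearEquiv.apply_symm_apply] at h1
  rw [h1]

theorem signature_signature (x : H) : D.signature (D.signature x) = x := by
  have hx := Submodule.projection_add_projection_eq_self D.isCompl x
  set a := D.pos.projection D.neg D.isCompl x with ha
  set b := D.neg.projection D.pos D.isCompl.symm x with hb
  have hJ : D.signature x = a - b := rfl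
  have hap : a ∈ D.pos := Submodule.projection_apply_mem _ _
  have hbn : b ∈ D.neg := Submodule.projection_apply_mem _ _
  rw [hJ, signature]
  simp only [LinearMap.sub_apply, map_sub,
    Submodule.projection_apply_of_mem_left D.isCompl hap,
    Submodule.projection_apply_of_mem_right D.isCompl hbn,
    Submodule.projection_apply_of_mem_left D.isCompl.symm hbn,
    Submodule.projection_apply_of_mem_right D.isCompl.symm hap]
  rw [← hx]; abel

theorem form_signature_comm (x y : H) :
    M.form (D.signature x) y = M.form x (D.signature y) :=
  (D.core.conj_inner_symm x y).symm.trans (M.isSymm.eq _ _)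

theorem form_eq_inner (x y : H) :
    M.form x y = inner ℂ (D.toSpace x) (D.toSpace (D.signature y)) := by
  rw [inner_toSpace, form_signature_comm, signature_signature]

theorem norm_toSpace_signature (x : H) : ‖D.toSpace (D.signature x)‖ = ‖D.toSpace x‖ := by
  rw [← sq_eq_sq₀ (norm_nonneg _) (norm_nonneg _), norm_toSpace_sq, norm_toSpace_sq,
    signature_signature, form_signature_comm]

/-- Any two fundamental decompositions induce the same topology. -/
theorem continuous_toSpace (D D' : FundamentalDecomposition M) :
    Continuous (fun x : D.Space => D'.toSpace (D.toSpace.symm x)) := by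
  let T : D.Space →ₗ[ℂ] D'.Space := D'.toSpace.toLinearMap ∘ₗ D.toSpace.symm.toLinearMap
  change Continuous T
  refine T.continuous_of_seq_closed_graph fun u x y hu hTu => ?_
  have key (z : H) : M.form (D.toSpace.symm x) z = M.form (D'.toSpace.symm y) z := by
    have h1 := (hu.inner (tendsto_const_nhds (x := D.toSpace (D.signature z))) (𝕜 := ℂ))
    have h2 := (hTu.inner (tendsto_const_nhds (x := D'.toSpace (D'.signature z))) (𝕜 := ℂ))
    rw [D.form_eq_inner, D'.form_eq_inner]
    simp only [LinearEquiv.apply_symm_apply]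
    refine tendsto_nhds_unique h1 (h2.congr fun k => ?_)
    have := D.form_eq_inner (D.toSpace.symm (u k)) z
    rw [D'.form_eq_inner, LinearEquiv.apply_symm_apply] at this
    exact this
  set w := D.toSpace.symm x - D'.toSpace.symm y with hw
  have h0 : ‖D'.toSpace w‖ ^ 2 = 0 := by
    rw [norm_toSpace_sq, form_signature_comm, hw, map_sub, LinearMap.sub_apply, key, sub_self,
      Complex.zero_re]
  have h1 : w = 0 := by simpa using h0
  have h2 : D.toSpace.symm x = D'.toSpace.symm y := sub_eq_zero.mp h1
  change y = D'.toSpace (D.toSpace.symm x)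
  rw [h2, LinearEquiv.apply_symm_apply]

end FundamentalDecomposition

namespace IndefiniteMetric

variable (M : IndefiniteMetric H)

/-- `T ∈ L(H)`: `T` is bounded in a Hilbert space associated with the Krein space `H`. (The choice
of the associated Hilbert space does not matter, as their norms are equivalent.) -/
def IsBoundedOp (T : H →ₗ[ℂ] H) : Prop :=
  ∃ D : FundamentalDecomposition M, Continuous fun x : D.Space => D.toSpace (T (D.toSpace.symm x))

/-- `T = T^#` for the adjoint with respect to the indefinite metric. -/
def IsSelfAdjointOp (T : H →ₗ[ℂ] H) : Prop :=
  ∀ x y, M.form (T x) y = M.form x (T y)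

/-- `S` is closed in a Hilbert space associated with the Krein space `H`. (The choice
of the associated Hilbert space does not matter, as their norms are equivalent.) -/
def IsClosedSubspace (S : Submodule ℂ H) : Prop :=
  ∃ D : FundamentalDecomposition M, IsClosed (D.toSpace.symm ⁻¹' (S : Set H))

end IndefiniteMetric

namespace FundamentalDecomposition

variable {M : IndefiniteMetric H} (D : FundamentalDecomposition M)

/-- The operator `J W` as a bounded operator on the Hilbert space associated with `J`. -/
noncomputable def signatureMul (W : H →ₗ[ℂ] H) (hW : M.IsBoundedOp W) :
    D.Space →L[ℂ] D.Space where
  toLinearMap := D.toSpace.toLinearMap ∘ₗ (D.signature ∘ₗ W) ∘ₗ D.toSpace.symm.toLinearMap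
  cont := by
    obtain ⟨D', hD'⟩ := hW
    let j : D.Space →ₗ[ℂ] D.Space :=
      D.toSpace.toLinearMap ∘ₗ D.signature ∘ₗ D.toSpace.symm.toLinearMap
    have hj : Continuous j :=
      AddMonoidHomClass.continuous_of_bound j 1 fun x => by
        rw [one_mul]; exact (D.norm_toSpace_signature (D.toSpace.symm x)).le
    exact hj.comp ((continuous_toSpace D' D).comp (hD'.comp (continuous_toSpace D D')))

/-- The subspace `S` of `H`, as a subspace of the Hilbert space associated with `J`. -/
noncomputable def subspace (S : Submodule ℂ H) : Submodule ℂ D.Space :=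
  S.comap D.toSpace.symm.toLinearMap

theorem completeSpace_subspace {S : Submodule ℂ H} (hS : M.IsClosedSubspace S) :
    CompleteSpace (D.subspace S) := by
  obtain ⟨D', hD'⟩ := hS
  exact (hD'.preimage (continuous_toSpace D D')).completeSpace_coe

/-- `W` is `S`-weakly complementable with respect to the signature operator `J`: the operator `JW`
is `S`-weakly complementable in the Hilbert space associated with `J`. -/
def WeaklyComplementable (W : H →ₗ[ℂ] H) (hW : M.IsBoundedOp W) (S : Submodule ℂ H)
    (hS : M.IsClosedSubspace S) : Prop :=
  haveI := D.completeSpace_subspace hS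
  IsWeaklyComplementable (D.signatureMul W hW) (D.subspace S)

/-- The Schur complement `J (JW)_{/S}` of `W` to `S` corresponding to the signature operator `J`. -/
noncomputable def schur (W : H →ₗ[ℂ] H) (hW : M.IsBoundedOp W) (S : Submodule ℂ H)
    (hS : M.IsClosedSubspace S) (h : D.WeaklyComplementable W hW S hS) : H →ₗ[ℂ] H :=
  haveI := D.completeSpace_subspace hS
  D.signature ∘ₗ D.toSpace.symm.toLinearMap ∘ₗ
    (schurComplement (D.signatureMul W hW) (D.subspace S) h).toLinearMap ∘ₗ
      D.toSpace.toLinearMap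

end FundamentalDecomposition

/-- `W` is `S`-weakly complementable in the Krein space `H`: it is so with respect to some signature
operator. -/
def IndefiniteMetric.WeaklyComplementable (M : IndefiniteMetric H) (W : H →ₗ[ℂ] H)
    (hW : M.IsBoundedOp W) (S : Submodule ℂ H) (hS : M.IsClosedSubspace S) : Prop :=
  ∃ D : FundamentalDecomposition M, D.WeaklyComplementable W hW S hS

end KreinSpace

/-! The form `[x, W y]` does not involve `J`, and `J W` represents it in the Hilbert space of `J`.
So it suffices to describe weak complementability and the Schur complement by this form and the
seminorm `p_J(s) = ‖|a|^{1/2} s‖` on `S`, in a way that is insensitive to replacing `p_J` by an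
equivalent seminorm. Equivalence: the compressions `a`, `a'` for two signature operators represent
one form on `S` under equivalent inner products. Their moduli are not congruent, but the norms of `a
s` and `a' s` are comparable, and operator monotonicity of the square root turns this into
comparability of `|a|` and `|a'|` as forms (`exists_norm_modulusSqrt_le`). Complementability: it
says that each functional `[s, W y]` on `S` is `p_J`-bounded (`isWeaklyComplementable_iff`). Schur
complement: for each `ε > 0` there is `s ∈ S` with `|[x - s, W t]| ≤ ε p_J(t)` on `S`, and for all
such `s` the number `[x - s, W y]` is within `O(ε)` of `[x, J (JW)_{/S} y]`. An `s` chosen for one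
`J` serves every other with `ε` rescaled, so the limits agree. -/

section HilbertLemmas

/-! ### Square roots of moduli, range criteria and polar factors in a Hilbert space. -/

variable {H K : Type*}
  [NormedAddCommGroup H] [InnerProductSpace ℂ H] [CompleteSpace H]
  [NormedAddCommGroup K] [InnerProductSpace ℂ K] [CompleteSpace K]

/-- Operator monotonicity of the square root, in terms of norms of vectors. -/
theorem le_of_norm_apply_le {P Q : H →L[ℂ] H} (hP : 0 ≤ P) (hQ : 0 ≤ Q)
    (h : ∀ x, ‖P x‖ ≤ ‖Q x‖) : P ≤ Q := by
  have hPs : ContinuousLinearMap.adjoint P = P := (IsSelfAdjoint.of_nonneg hP).star_eq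
  have hQs : ContinuousLinearMap.adjoint Q = Q := (IsSelfAdjoint.of_nonneg hQ).star_eq
  -- The hypothesis is the form inequality `P² ≤ Q²`; the square root then preserves it.
  have key : P * P ≤ Q * Q := by
    rw [ContinuousLinearMap.le_def, ContinuousLinearMap.isPositive_def']
    refine ⟨?_, fun x => ?_⟩
    · exact ((IsSelfAdjoint.of_nonneg hQ).commute_iff (IsSelfAdjoint.of_nonneg hQ)).mp rfl |>.sub
        (((IsSelfAdjoint.of_nonneg hP).commute_iff (IsSelfAdjoint.of_nonneg hP)).mp rfl)
    · have h1 := P.apply_norm_sq_eq_inner_adjoint_left x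
      have h2 := Q.apply_norm_sq_eq_inner_adjoint_left x
      rw [hPs] at h1
      rw [hQs] at h2
      have h3 : ‖P x‖ ^ 2 ≤ ‖Q x‖ ^ 2 := by gcongr; exact h x
      rw [ContinuousLinearMap.reApplyInnerSelf_apply, sub_apply,
        inner_sub_left, map_sub]
      rw [h1, h2] at h3
      exact sub_nonneg.mpr h3
  simpa only [CFC.sqrt_mul_self P, CFC.sqrt_mul_self Q] using CFC.sqrt_le_sqrt _ _ key

theorem adjoint_modulusSqrt (T : H →L[ℂ] H) :
    ContinuousLinearMap.adjoint (modulusSqrt T) = modulusSqrt T :=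
  (IsSelfAdjoint.of_nonneg (CFC.sqrt_nonneg (CFC.abs T))).star_eq

theorem inner_modulusSqrt_left (T : H →L[ℂ] H) (x y : H) :
    inner ℂ (modulusSqrt T x) y = inner ℂ x (modulusSqrt T y) := by
  conv_rhs => rw [← adjoint_modulusSqrt T]
  exact (ContinuousLinearMap.adjoint_inner_right _ _ _).symm

theorem modulusSqrt_apply_modulusSqrt (T : H →L[ℂ] H) (x : H) :
    modulusSqrt T (modulusSqrt T x) = CFC.abs T x :=
  congrArg (fun A : H →L[ℂ] H => A x) (CFC.sqrt_mul_sqrt_self (CFC.abs T) (CFC.abs_nonneg T))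

theorem norm_abs_apply (T : H →L[ℂ] H) (x : H) : ‖CFC.abs T x‖ = ‖T x‖ := by
  have hA : ContinuousLinearMap.adjoint (CFC.abs T) = CFC.abs T :=
    (IsSelfAdjoint.of_nonneg (CFC.abs_nonneg T)).star_eq
  have hAA : ContinuousLinearMap.adjoint (CFC.abs T) ∘L CFC.abs T =
      ContinuousLinearMap.adjoint T ∘L T := by
    rw [hA]; exact CFC.abs_mul_abs T
  rw [← sq_eq_sq₀ (norm_nonneg _) (norm_nonneg _),
    T.apply_norm_sq_eq_inner_adjoint_left,
    (CFC.abs T).apply_norm_sq_eq_inner_adjoint_left, hAA]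

theorem norm_modulusSqrt_sq (T : H →L[ℂ] H) (x : H) :
    ‖modulusSqrt T x‖ ^ 2 = (inner ℂ (CFC.abs T x) x).re := by
  rw [norm_sq_eq_re_inner (𝕜 := ℂ), ← inner_modulusSqrt_left, modulusSqrt_apply_modulusSqrt]
  rfl

/-- If two operators represent the same sesquilinear form with respect to two equivalent inner
products, then the seminorms `‖|T|^{1/2} x‖` are comparable. -/
theorem exists_norm_modulusSqrt_le (V : H ≃L[ℂ] K) (T : H →L[ℂ] H) (T' : K →L[ℂ] K)
    (h : ∀ x y, inner ℂ x (T y) = inner ℂ (V x) (T' (V y))) :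
    ∃ k : ℝ, 0 ≤ k ∧ ∀ x, ‖modulusSqrt T' (V x)‖ ≤ k * ‖modulusSqrt T x‖ := by
  set V₁ : H →L[ℂ] K := V.toContinuousLinearMap
  set V₂ : K →L[ℂ] H := V.symm.toContinuousLinearMap
  set c : ℝ := ‖V₁‖ * ‖V₂‖ with hc
  have hc0 : 0 ≤ c := by positivity
  have hV₁₂ (x : K) : V (V₂ x) = x := V.apply_symm_apply x
  have hT' (x : H) : ‖T' (V x)‖ ≤ ‖V₂‖ * ‖T x‖ := by
    -- Test against `z = V (V₂ z)`.
    have h1 : T' (V x) = ContinuousLinearMap.adjoint V₂ (T x) := by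
      refine ext_inner_left ℂ fun z => ?_
      rw [ContinuousLinearMap.adjoint_inner_right, h, hV₁₂]
    rw [h1]
    refine (ContinuousLinearMap.le_opNorm _ _).trans_eq ?_
    rw [LinearIsometryEquiv.norm_map]
  set P : H →L[ℂ] H := ContinuousLinearMap.adjoint V₁ ∘L CFC.abs T' ∘L V₁ with hP
  have hP0 : 0 ≤ P := by
    have := (ContinuousLinearMap.nonneg_iff_isPositive _).mp (CFC.abs_nonneg T')
    exact (ContinuousLinearMap.nonneg_iff_isPositive _).mpr (this.adjoint_conj V₁)
  have hQ0 : 0 ≤ c • CFC.abs T := smul_nonneg hc0 (CFC.abs_nonneg T)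
  -- Only vector norms are compared: `‖P x‖ ≤ ‖V₁‖ ‖T' V x‖ ≤ ‖V₁‖ ‖V₂‖ ‖T x‖`, and `T` and `|T|`
  -- have the same norms on vectors. This is where `c` comes from.
  have hle : P ≤ c • CFC.abs T := by
    refine le_of_norm_apply_le hP0 hQ0 fun x => ?_
    have h1 : ‖P x‖ ≤ ‖V₁‖ * ‖CFC.abs T' (V x)‖ := by
      refine ((ContinuousLinearMap.adjoint V₁).le_opNorm (CFC.abs T' (V₁ x))).trans_eq ?_
      rw [LinearIsometryEquiv.norm_map]; rfl
    rw [smul_apply, norm_smul, Real.norm_of_nonneg hc0, norm_abs_apply]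
    rw [norm_abs_apply] at h1
    calc ‖P x‖ ≤ ‖V₁‖ * (‖V₂‖ * ‖T x‖) := h1.trans (by gcongr; exact hT' x)
      _ = c * ‖T x‖ := by rw [hc]; ring
  refine ⟨Real.sqrt c, Real.sqrt_nonneg c, fun x => ?_⟩
  rw [← sq_le_sq₀ (norm_nonneg _) (by positivity), mul_pow, Real.sq_sqrt hc0,
    norm_modulusSqrt_sq, norm_modulusSqrt_sq]
  have h1 := ((ContinuousLinearMap.le_def _ _).mp hle).re_inner_nonneg_left x
  rw [sub_apply, inner_sub_left, map_sub, sub_nonneg, hP,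
    ContinuousLinearMap.comp_apply, ContinuousLinearMap.adjoint_inner_left,
    smul_apply, RCLike.real_smul_eq_coe_smul (K := ℂ), inner_smul_left] at h1
  simpa [V₁] using h1

/-- A vector `v` lies in the range of a selfadjoint operator `A` as soon as the functional `⟨v, ·⟩`
is bounded by a multiple of `‖A ·‖`. -/
theorem mem_range_of_norm_inner_le {A : H →L[ℂ] H} (hA : ContinuousLinearMap.adjoint A = A)
    {v : H} {C : ℝ} (h : ∀ x, ‖inner ℂ v x‖ ≤ C * ‖A x‖) : v ∈ A.range := by
  set R := A.range.topologicalClosure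
  let e : H →ₗ[ℂ] R := (A : H →ₗ[ℂ] H).codRestrict R
    fun x => Submodule.le_topologicalClosure _ ⟨x, rfl⟩
  have hdense : DenseRange e := by
    intro y
    rw [closure_subtype]
    have hy : (y : H) ∈ closure (A.range : Set H) := y.2
    convert hy using 2
    ext z
    constructor
    · rintro ⟨_, ⟨x, rfl⟩, rfl⟩; exact ⟨x, rfl⟩
    · rintro ⟨x, rfl⟩; exact ⟨e x, ⟨x, rfl⟩, rfl⟩
  -- The bound makes `A x ↦ ⟨v, x⟩` well defined and continuous on `R(A)`. The Riesz vector of its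
  -- extension to the closure is a preimage of `v`, because `A` is selfadjoint.
  let g : R →L[ℂ] ℂ := ((innerSL ℂ v : H →L[ℂ] ℂ) : H →ₗ[ℂ] ℂ).extendOfNorm e
  have hg (x : H) : g (e x) = inner ℂ v x := LinearMap.extendOfNorm_eq hdense ⟨C, h⟩ x
  refine ⟨((InnerProductSpace.toDual ℂ R).symm g : R), ?_⟩
  refine ext_inner_right ℂ fun x => ?_
  rw [← hg, ← InnerProductSpace.toDual_symm_apply (y := g)]
  have hsymm (w : H) : inner ℂ (A w) x = inner ℂ w (A x) := by
    rw [← ContinuousLinearMap.adjoint_inner_left, hA]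
  exact hsymm _

/-- A vector in the closure of `R(A)` has norm at most `ε` if it is bounded by `ε` as a functional
on `R(A)`. -/
theorem norm_le_of_mem_closure_range {H : Type*} [NormedAddCommGroup H] [InnerProductSpace ℂ H]
    {A : H →L[ℂ] H} {z : H}
    (hz : z ∈ A.range.topologicalClosure) {ε : ℝ} (hε : 0 ≤ ε)
    (h : ∀ t, ‖inner ℂ z (A t)‖ ≤ ε * ‖A t‖) : ‖z‖ ≤ ε := by
  have hcl : IsClosed {r : H | ‖inner ℂ z r‖ ≤ ε * ‖r‖} :=
    isClosed_le (by fun_prop) (by fun_prop)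
  have hsub : closure (A.range : Set H) ⊆ {r : H | ‖inner ℂ z r‖ ≤ ε * ‖r‖} := by
    refine closure_minimal ?_ hcl
    rintro _ ⟨t, rfl⟩
    exact h t
  -- The estimate extends by continuity to the closure, which contains `z` itself.
  have h1 : ‖inner ℂ z z‖ ≤ ε * ‖z‖ := hsub hz
  rw [inner_self_eq_norm_sq_to_K] at h1
  by_cases hz0 : z = 0
  · simpa [hz0] using hε
  · have h2 : 0 < ‖z‖ := norm_pos_iff.mpr hz0
    have h3 : ‖z‖ ^ 2 ≤ ε * ‖z‖ := by simpa using h1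
    nlinarith

namespace IsPolarFactor

variable {a u : H →L[ℂ] H}

theorem apply_abs (hu : IsPolarFactor a u) (x : H) : u (CFC.abs a x) = a x :=
  (congrArg (fun T : H →L[ℂ] H => T x) hu.comp_abs).symm

/-- An operator that vanishes on `R(|a|)` and on `N(a)` is zero. -/
theorem eq_of_eq_on_abs {T₁ T₂ : H →L[ℂ] H} (h₁ : ∀ x, T₁ (CFC.abs a x) = T₂ (CFC.abs a x))
    (h₂ : ∀ x, a x = 0 → T₁ x = T₂ x) (x : H) : T₁ x = T₂ x := by
  set A : H →L[ℂ] H := CFC.abs a with hA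
  have hAsa : ContinuousLinearMap.adjoint A = A :=
    (IsSelfAdjoint.of_nonneg (CFC.abs_nonneg a)).star_eq
  have hcl : IsClosed (A.ker : Set H) := A.isClosed_ker
  have : CompleteSpace A.ker := hcl.completeSpace_coe
  -- The space splits as `N(|a|) ⊕ closure R(|a|)`, with `N(|a|) = N(a)`.
  rw [← A.ker.starProjection_add_starProjection_orthogonal x, map_add, map_add]
  congr 1
  · refine h₂ _ ?_
    have h3 : A (A.ker.starProjection x) = 0 := A.ker.starProjection_apply_mem x
    rw [← norm_eq_zero, ← norm_abs_apply, ← hA, h3, norm_zero]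
  · have h3 : A.kerᗮ.starProjection x ∈ A.kerᗮ := Submodule.starProjection_apply_mem _ _
    have h4 : A.kerᗮ = A.range.topologicalClosure := by rw [A.orthogonal_ker, hAsa]
    have hsub : closure (A.range : Set H) ⊆ {r | T₁ r = T₂ r} := by
      refine closure_minimal ?_ (isClosed_eq (by fun_prop) (by fun_prop))
      rintro _ ⟨t, rfl⟩
      exact h₁ t
    exact hsub (h4.le h3)

theorem apply_eq_zero (hu : IsPolarFactor a u) {x : H} (hx : a x = 0) : u x = 0 := by
  have : x ∈ u.ker := by rw [hu.ker_eq]; exact hx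
  exact this

theorem norm_apply_le (hu : IsPolarFactor a u) (x : H) : ‖u x‖ ≤ ‖x‖ := by
  have hcl : IsClosed (u.ker : Set H) := u.isClosed_ker
  have : CompleteSpace u.ker := hcl.completeSpace_coe
  have h1 := u.ker.starProjection_add_starProjection_orthogonal x
  have h2 : u (u.ker.starProjection x) = 0 := u.ker.starProjection_apply_mem x
  have h3 : u x = u (u.kerᗮ.starProjection x) := by
    conv_lhs => rw [← h1, map_add, h2, zero_add]
  rw [h3, hu.isometry_on _ (Submodule.starProjection_apply_mem _ _)]
  exact Submodule.norm_starProjection_apply_le _ _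

theorem commute_modulusSqrt_self (ha : IsSelfAdjoint a) (x : H) : modulusSqrt a (a x) = a (modulusSqrt a x) := by
  have h1 : Commute (CFC.abs a) a := CFC.commute_abs_self a ha.isStarNormal
  have h2 : Commute (modulusSqrt a) a := h1.cfcₙ_nnreal _
  exact congrArg (fun T : H →L[ℂ] H => T x) h2.eq

theorem abs_apply_abs_apply (ha : IsSelfAdjoint a) (x : H) : CFC.abs a (CFC.abs a x) = a (a x) := by
  have h1 := CFC.abs_mul_abs a
  rw [ha.star_eq] at h1
  exact congrArg (fun T : H →L[ℂ] H => T x) h1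

theorem modulusSqrt_apply_eq_zero {x : H} (hx : a x = 0) : modulusSqrt a x = 0 := by
  have h1 : CFC.abs a x = 0 := by rw [← norm_eq_zero, norm_abs_apply, hx, norm_zero]
  have h2 := norm_modulusSqrt_sq a x
  rw [h1, inner_zero_left] at h2
  simpa using h2

/-- On `R(|a|)`, `u|a| = a` reduces the claim to `|a|^{1/2}` commuting with `a`; on `N(a)` both
sides vanish. -/
theorem commute_modulusSqrt (hu : IsPolarFactor a u)
    (ha : IsSelfAdjoint a) (x : H) : u (modulusSqrt a x) = modulusSqrt a (u x) := by
  refine eq_of_eq_on_abs (a := a) (T₁ := u ∘L modulusSqrt a) (T₂ := modulusSqrt a ∘L u)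
    (fun x => ?_) (fun x hx => ?_) x
  · simp only [ContinuousLinearMap.comp_apply]
    rw [hu.apply_abs, ← modulusSqrt_apply_modulusSqrt a x, modulusSqrt_apply_modulusSqrt a (modulusSqrt a x),
      hu.apply_abs, commute_modulusSqrt_self ha]
  · simp only [ContinuousLinearMap.comp_apply]
    rw [modulusSqrt_apply_eq_zero hx, hu.apply_eq_zero hx, map_zero, map_zero]

theorem commute_abs (hu : IsPolarFactor a u)
    (ha : IsSelfAdjoint a) (x : H) : u (CFC.abs a x) = CFC.abs a (u x) := by
  rw [← modulusSqrt_apply_modulusSqrt, hu.commute_modulusSqrt ha, hu.commute_modulusSqrt ha,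
    modulusSqrt_apply_modulusSqrt]

theorem modulusSqrt_polar_modulusSqrt (hu : IsPolarFactor a u)
    (ha : IsSelfAdjoint a) (x : H) : modulusSqrt a (u (modulusSqrt a x)) = a x := by
  rw [← hu.commute_modulusSqrt ha, modulusSqrt_apply_modulusSqrt, hu.apply_abs]

/-- For selfadjoint `a`, `u² |a|² = a² = |a|²`, so `u²` acts as the identity on `R(|a|)`. Checking
on `R(|a|)` and `N(a)` is done twice, to descend from `|a|²` to `|a|` and then to `|a|^{1/2}`. -/
theorem apply_apply_modulusSqrt (hu : IsPolarFactor a u)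
    (ha : IsSelfAdjoint a) (x : H) : u (u (modulusSqrt a x)) = modulusSqrt a x := by
  refine eq_of_eq_on_abs (a := a) (T₁ := u ∘L u ∘L modulusSqrt a) (T₂ := modulusSqrt a)
    (fun x => ?_) (fun x hx => ?_) x
  · simp only [ContinuousLinearMap.comp_apply]
    have h1 (y : H) : modulusSqrt a (CFC.abs a y) = CFC.abs a (modulusSqrt a y) := by
      simp only [← modulusSqrt_apply_modulusSqrt]
    rw [h1]
    set y := modulusSqrt a x
    -- `u² |a|` and `|a|` agree on `R(|a|)` and on `N(a)`
    refine eq_of_eq_on_abs (a := a) (T₁ := u ∘L u ∘L CFC.abs a) (T₂ := CFC.abs a)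
      (fun x => ?_) (fun x hx => ?_) y
    · simp only [ContinuousLinearMap.comp_apply]
      have h2 : a (CFC.abs a x) = CFC.abs a (a x) := by
        rw [← hu.apply_abs (CFC.abs a x), hu.commute_abs ha, hu.apply_abs]
      rw [hu.apply_abs, h2, hu.apply_abs, abs_apply_abs_apply ha]
    · have : CFC.abs a x = 0 := by rw [← norm_eq_zero, norm_abs_apply, hx, norm_zero]
      simp [this]
  · simp [modulusSqrt_apply_eq_zero hx]

/-- On `R(|a|)`: `u*|a| = (|a|u)* = a = u|a|`. On `N(a)`: `|a|u* = a` puts `u* x` in `N(a) = N(u)`,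
whence `‖u* x‖² = ⟨x, u u* x⟩ = 0`. -/
theorem adjoint_eq (hu : IsPolarFactor a u) (ha : IsSelfAdjoint a) : ContinuousLinearMap.adjoint u = u := by
  have haa : ContinuousLinearMap.adjoint a = a := ha.star_eq
  have hAsa : ContinuousLinearMap.adjoint (CFC.abs a) = CFC.abs a :=
    (IsSelfAdjoint.of_nonneg (CFC.abs_nonneg a)).star_eq
  have h1 : CFC.abs a ∘L u = a := by
    ext x; exact (hu.commute_abs ha x).symm.trans (hu.apply_abs x)
  have h2 : ContinuousLinearMap.adjoint u ∘L CFC.abs a = a := by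
    have := congrArg ContinuousLinearMap.adjoint h1
    rwa [ContinuousLinearMap.adjoint_comp, hAsa, haa] at this
  have h3 : CFC.abs a ∘L ContinuousLinearMap.adjoint u = a := by
    have := congrArg ContinuousLinearMap.adjoint hu.comp_abs
    rw [ContinuousLinearMap.adjoint_comp, hAsa, haa] at this
    exact this.symm
  ext x
  refine eq_of_eq_on_abs (a := a) (fun x => ?_) (fun x hx => ?_) x
  · rw [hu.apply_abs]
    exact congrArg (fun T : H →L[ℂ] H => T x) h2
  · rw [hu.apply_eq_zero hx]
    have h4 : CFC.abs a (ContinuousLinearMap.adjoint u x) = 0 :=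
      (congrArg (fun T : H →L[ℂ] H => T x) h3).trans hx
    have h5 : a (ContinuousLinearMap.adjoint u x) = 0 := by
      rw [← norm_eq_zero, ← norm_abs_apply, h4, norm_zero]
    have h6 := hu.apply_eq_zero h5
    rw [← inner_self_eq_zero (𝕜 := ℂ), ContinuousLinearMap.adjoint_inner_left, h6,
      inner_zero_right]

end IsPolarFactor

end HilbertLemmas

/-! ### Complementability and the Schur complement in terms of the form `⟨·, B ·⟩`. -/

section SchurComplement

variable {H : Type*} [NormedAddCommGroup H] [InnerProductSpace ℂ H]
  {B : H →L[ℂ] H} {S : Submodule ℂ H} [CompleteSpace S]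

theorem inner_blockA (B : H →L[ℂ] H) (s t : S) :
    inner ℂ s (blockA B S t) = inner ℂ (s : H) (B t) :=
  Submodule.inner_orthogonalProjectionOnto_eq_of_mem_left s (B t)

theorem inner_blockB (B : H →L[ℂ] H) (s : S) (y : Sᗮ) :
    inner ℂ s (blockB B S y) = inner ℂ (s : H) (B y) :=
  Submodule.inner_orthogonalProjectionOnto_eq_of_mem_left s (B y)

theorem inner_blockC (B : H →L[ℂ] H) (x y : Sᗮ) :
    inner ℂ x (blockC B S y) = inner ℂ (x : H) (B y) :=
  Submodule.inner_orthogonalProjectionOnto_eq_of_mem_left x (B y)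

theorem exists_decomposition (S : Submodule ℂ H) [CompleteSpace S] (x : H) :
    ∃ (x₁ : S) (x₂ : Sᗮ), x = x₁ + x₂ ∧ Sᗮ.orthogonalProjectionOnto x = x₂ :=
  ⟨S.orthogonalProjectionOnto x, Sᗮ.orthogonalProjectionOnto x,
    (S.starProjection_add_starProjection_orthogonal x).symm, rfl⟩

theorem IsReducedSolution.mem_closure_range {f : Sᗮ →L[ℂ] S}
    (hf : IsReducedSolution (modulusSqrt (blockA B S)) (blockB B S) f) (x : Sᗮ) :
    f x ∈ (modulusSqrt (blockA B S)).range.topologicalClosure := by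
  have := hf.range_le ⟨x, rfl⟩
  rwa [adjoint_modulusSqrt] at this

variable [CompleteSpace H]

theorem inner_apply_comm (hB : IsSelfAdjoint B) (x y : H) :
    inner ℂ (B x) y = inner ℂ x (B y) := by
  rw [← ContinuousLinearMap.adjoint_inner_right, show ContinuousLinearMap.adjoint B = B from
    hB.star_eq]

theorem isSelfAdjoint_blockA (hB : IsSelfAdjoint B) : IsSelfAdjoint (blockA B S) := by
  rw [ContinuousLinearMap.isSelfAdjoint_iff_isSymmetric]
  intro s t
  change inner ℂ (blockA B S s) t = inner ℂ s (blockA B S t)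
  rw [inner_blockA, ← inner_conj_symm, inner_blockA, inner_conj_symm, inner_apply_comm hB]

/-- Weak complementability in terms of the sesquilinear form `⟨·, B ·⟩` and the seminorm
`‖|a|^{1/2} ·‖` on `S`. -/
theorem isWeaklyComplementable_iff (hB : IsSelfAdjoint B) :
    IsWeaklyComplementable B S ↔ ∀ y : H, ∃ C : ℝ, ∀ s : S,
      ‖inner ℂ (s : H) (B y)‖ ≤ C * ‖modulusSqrt (blockA B S) s‖ := by
  set a := blockA B S with ha
  have hu := (exists_isPolarFactor a).choose_spec
  set u := (exists_isPolarFactor a).choose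
  have hasa : IsSelfAdjoint a := isSelfAdjoint_blockA hB
  constructor
  -- The vector `y` ranges over the whole space, not only over `Sᗮ`, since `Sᗮ` depends on the inner
  -- product. The extra part is harmless: `a y₁ = |a|^{1/2} u |a|^{1/2} y₁` also lies in
  -- `R(|a|^{1/2})`.
  · intro h y
    obtain ⟨y₁, y₂, rfl, -⟩ := exists_decomposition S y
    obtain ⟨w, hw⟩ : blockB B S y₂ ∈ (modulusSqrt a).range := h ⟨y₂, rfl⟩
    refine ⟨‖u (modulusSqrt a y₁) + w‖, fun s => ?_⟩
    have h1 : inner ℂ (s : H) (B (y₁ + y₂)) =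
        inner ℂ (modulusSqrt a s) (u (modulusSqrt a y₁) + w) := by
      rw [map_add, inner_add_right, ← inner_blockA, ← inner_blockB, ← ha, ← hw,
        inner_modulusSqrt_left, map_add, hu.modulusSqrt_polar_modulusSqrt hasa, inner_add_right]
      rfl
    rw [h1, mul_comm]
    exact norm_inner_le_norm _ _
  · rintro h _ ⟨y, rfl⟩
    obtain ⟨C, hC⟩ := h y
    refine mem_range_of_norm_inner_le (C := C) (adjoint_modulusSqrt a) fun s => ?_
    rw [norm_inner_symm]
    exact (congrArg _ (inner_blockB B s y)).trans_le (hC s)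

/-- Both `b = |a|^{1/2} f` and `a = |a|^{1/2} u |a|^{1/2}` factor through `|a|^{1/2}`. The residual
`f x - u |a|^{1/2} w` thus measures how far `x - w` is from being `B`-orthogonal to `S`. -/
theorem IsReducedSolution.inner_sub_apply {f : Sᗮ →L[ℂ] S} {u : S →L[ℂ] S}
    (hB : IsSelfAdjoint B)
    (hf : IsReducedSolution (modulusSqrt (blockA B S)) (blockB B S) f)
    (hu : IsPolarFactor (blockA B S) u) (x : Sᗮ) (w t : S) :
    inner ℂ ((x : H) - w) (B t) =
      inner ℂ (f x - u (modulusSqrt (blockA B S) w)) (modulusSqrt (blockA B S) t) := by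
  have ha : IsSelfAdjoint (blockA B S) := isSelfAdjoint_blockA hB
  have h1 : inner ℂ (x : H) (B t) = inner ℂ (f x) (modulusSqrt (blockA B S) t) := by
    rw [← inner_modulusSqrt_left, ← inner_apply_comm hB, ← inner_conj_symm, ← inner_blockB,
      hf.comp_eq, inner_conj_symm]
    rfl
  have h2 : inner ℂ (w : H) (B t) =
      inner ℂ (u (modulusSqrt (blockA B S) w)) (modulusSqrt (blockA B S) t) := by
    rw [← inner_modulusSqrt_left, hu.modulusSqrt_polar_modulusSqrt ha, inner_apply_comm ha,
      inner_blockA]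
  rw [inner_sub_left, inner_sub_left, h1, h2]

/-- For every `x` there are `s ∈ S` for which the functional `⟨x - s, B ·⟩` on `S` is arbitrarily
small with respect to the seminorm `‖|a|^{1/2} ·‖`. -/
theorem IsWeaklyComplementable.exists_norm_inner_sub_le (h : IsWeaklyComplementable B S)
    (hB : IsSelfAdjoint B) (x : H) {ε : ℝ} (hε : 0 < ε) :
    ∃ s : S, ∀ t : S, ‖inner ℂ (x - s) (B t)‖ ≤ ε * ‖modulusSqrt (blockA B S) t‖ := by
  have hf := (exists_isReducedSolution _ _ h).choose_spec
  set f := (exists_isReducedSolution _ _ h).choose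
  have hu := (exists_isPolarFactor (blockA B S)).choose_spec
  set u := (exists_isPolarFactor (blockA B S)).choose
  have ha : IsSelfAdjoint (blockA B S) := isSelfAdjoint_blockA hB
  obtain ⟨x₁, x₂, rfl, -⟩ := exists_decomposition S x
  obtain ⟨_, ⟨w, rfl⟩, hw⟩ := Metric.mem_closure_iff.mp (hf.mem_closure_range x₂) ε hε
  -- `f x₂` need only lie in the closure of `R(|a|^{1/2})`, so it is approximated by `|a|^{1/2} w`.
  -- With `u w` in place of `w` the residual is `f x₂ - u² |a|^{1/2} w = f x₂ - |a|^{1/2} w`.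
  refine ⟨x₁ + u w, fun t => ?_⟩
  have h1 : (x₁ + x₂ : H) - (x₁ + u w : S) = x₂ - (u w : S) := by push_cast; abel
  rw [h1, hf.inner_sub_apply hB hu, ← hu.commute_modulusSqrt ha, hu.apply_apply_modulusSqrt ha]
  refine (norm_inner_le_norm _ _).trans ?_
  gcongr
  exact (dist_eq_norm _ _).symm.trans_le hw.le

/-- If the functional `⟨x - s, B ·⟩` on `S` is small, then `⟨x - s, B y⟩` is close to the value of
the form of the Schur complement. -/
theorem IsWeaklyComplementable.exists_norm_sub_schurComplement_le
    (h : IsWeaklyComplementable B S) (hB : IsSelfAdjoint B) (x y : H) :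
    ∃ C : ℝ, ∀ ε : ℝ, 0 ≤ ε → ∀ s : S,
      (∀ t : S, ‖inner ℂ (x - s) (B t)‖ ≤ ε * ‖modulusSqrt (blockA B S) t‖) →
        ‖inner ℂ (x - s) (B y) - inner ℂ x (schurComplement B S h y)‖ ≤ ε * C := by
  have hf : IsReducedSolution _ _ (reducedSolution _ _ h) :=
    (exists_isReducedSolution _ _ h).choose_spec
  have hu : IsPolarFactor (blockA B S) (polarFactor (blockA B S)) :=
    (exists_isPolarFactor (blockA B S)).choose_spec
  have ha : IsSelfAdjoint (blockA B S) := isSelfAdjoint_blockA hB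
  obtain ⟨x₁, x₂, rfl, hx⟩ := exists_decomposition S x
  obtain ⟨y₁, y₂, rfl, hy⟩ := exists_decomposition S y
  have hschur : inner ℂ ((x₁ : H) + x₂) (schurComplement B S h (y₁ + y₂)) =
      inner ℂ (x₂ : H) (B y₂) - inner ℂ (reducedSolution _ _ h x₂)
        (polarFactor (blockA B S) (reducedSolution _ _ h y₂)) := by
    have h1 : schurComplement B S h (y₁ + y₂) = ((blockC B S y₂ - ContinuousLinearMap.adjoint
        (reducedSolution _ _ h) (polarFactor (blockA B S) (reducedSolution _ _ h y₂)) : Sᗮ) : H) :=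
      congrArg (fun v : Sᗮ => ((blockC B S v - ContinuousLinearMap.adjoint
        (reducedSolution _ _ h) (polarFactor (blockA B S) (reducedSolution _ _ h v)) : Sᗮ) : H)) hy
    rw [h1, inner_add_left, Submodule.inner_right_of_mem_orthogonal x₁.2 (Subtype.prop _),
      zero_add, ← Submodule.coe_inner, inner_sub_right, inner_blockC,
      ContinuousLinearMap.adjoint_inner_right]
  rw [hschur]
  set f := reducedSolution _ _ h
  set u := polarFactor (blockA B S)
  set A := modulusSqrt (blockA B S)
  refine ⟨‖A y₁‖ + ‖f y₂‖, fun ε hε s hs => ?_⟩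
  -- The Schur complement's form ignores the `S`-component of `x`, which is therefore absorbed into
  -- `s`.
  set w : S := s - x₁ with hw
  have hxs : (x₁ + x₂ : H) - s = x₂ - w := by rw [hw]; push_cast; abel
  rw [hxs] at hs ⊢
  set z := f x₂ - u (A w) with hz
  -- Smallness of the functional controls `‖z‖` because both terms of `z` lie in the closure of
  -- `R(|a|^{1/2})`.
  have hzε : ‖z‖ ≤ ε := by
    refine norm_le_of_mem_closure_range (A := A) (Submodule.sub_mem _ (hf.mem_closure_range x₂) ?_)
      hε fun t => ?_
    · rw [hu.commute_modulusSqrt ha]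
      exact Submodule.le_topologicalClosure _ ⟨_, rfl⟩
    · exact (congrArg _ (hf.inner_sub_apply hB hu x₂ w t)).symm.trans_le (hs t)
  have huz : u z = u (f x₂) - A w := by
    rw [hz, map_sub, hu.apply_apply_modulusSqrt ha]
  have husymm : inner ℂ (f x₂) (u (f y₂)) = inner ℂ (u (f x₂)) (f y₂) :=
    (inner_apply_comm (show IsSelfAdjoint u from hu.adjoint_eq ha) _ _).symm
  have hwb : inner ℂ (w : H) (B y₂) = inner ℂ (A w) (f y₂) := by
    rw [inner_modulusSqrt_left, ← inner_blockB, hf.comp_eq]; rfl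
  -- The error is linear in the residual `z`: the `y₁` part gives `⟨z, A y₁⟩`, and in the `y₂` part
  -- `u* = u` and `u² A = A` leave `⟨u f x₂ - A w, f y₂⟩ = ⟨u z, f y₂⟩`.
  have key : inner ℂ ((x₂ : H) - w) (B (y₁ + y₂)) -
      (inner ℂ (x₂ : H) (B y₂) - inner ℂ (f x₂) (u (f y₂))) =
      inner ℂ z (A y₁) + inner ℂ (u z) (f y₂) := by
    rw [map_add, inner_add_right, hf.inner_sub_apply hB hu, huz, husymm, inner_sub_left _ _ (f y₂),
      inner_sub_left _ _ (B y₂), hwb]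
    ring
  rw [key, mul_add]
  refine (norm_add_le _ _).trans (add_le_add ?_ ?_)
  · exact (norm_inner_le_norm _ _).trans (by gcongr)
  · refine (norm_inner_le_norm _ _).trans ?_
    gcongr
    exact (hu.norm_apply_le z).trans hzε

end SchurComplement

/-! ### Transfer to the Krein space and independence of the signature operator. -/

namespace FundamentalDecomposition

variable {H : Type*} [AddCommGroup H] [Module ℂ H] {M : IndefiniteMetric H}

/-- The form `[·, W ·]` is represented by `J W` in the Hilbert space associated with `J`. -/
theorem inner_signatureMul (D : FundamentalDecomposition M) {W : H →ₗ[ℂ] H}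
    (hW : M.IsBoundedOp W) (x y : H) :
    inner ℂ (D.toSpace x) (D.signatureMul W hW (D.toSpace y)) = M.form x (W y) :=
  (D.form_eq_inner x (W y)).symm

theorem isSelfAdjoint_signatureMul (D : FundamentalDecomposition M) {W : H →ₗ[ℂ] H}
    (hW : M.IsBoundedOp W) (hWsa : M.IsSelfAdjointOp W) :
    IsSelfAdjoint (D.signatureMul W hW) := by
  rw [ContinuousLinearMap.isSelfAdjoint_iff_isSymmetric]
  intro x y
  have h1 := D.inner_signatureMul hW (D.toSpace.symm x) (D.toSpace.symm y)
  have h2 := D.inner_signatureMul hW (D.toSpace.symm y) (D.toSpace.symm x)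
  simp only [LinearEquiv.apply_symm_apply] at h1 h2
  change inner ℂ (D.signatureMul W hW x) y = inner ℂ x (D.signatureMul W hW y)
  rw [h1, ← hWsa, ← M.isSymm.eq, ← h2]
  exact (inner_conj_symm (𝕜 := ℂ) (D.signatureMul W hW x) y).symm

/-- The identity map between the copies of a closed subspace in the Hilbert spaces associated with
two signature operators. -/
noncomputable def subspaceEquiv (D D' : FundamentalDecomposition M) (S : Submodule ℂ H) :
    D.subspace S ≃L[ℂ] D'.subspace S where
  toFun s := ⟨D'.toSpace (D.toSpace.symm s), s.2⟩
  invFun s := ⟨D.toSpace (D'.toSpace.symm s), s.2⟩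
  map_add' _ _ := rfl
  map_smul' _ _ := rfl
  left_inv _ := rfl
  right_inv _ := rfl
  continuous_toFun := ((continuous_toSpace D D').comp continuous_subtype_val).subtype_mk _
  continuous_invFun := ((continuous_toSpace D' D).comp continuous_subtype_val).subtype_mk _

/-- The seminorm `‖|a|^{1/2} s‖` of `s ∈ S`, where `a` is the compression of `J W` to `S` in the
Hilbert space associated with `J`. -/
noncomputable def modulusSeminorm (D : FundamentalDecomposition M) (W : H →ₗ[ℂ] H)
    (hW : M.IsBoundedOp W) (S : Submodule ℂ H) (hS : M.IsClosedSubspace S) (s : S) : ℝ :=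
  haveI := D.completeSpace_subspace hS
  ‖modulusSqrt (blockA (D.signatureMul W hW) (D.subspace S)) ⟨D.toSpace s, s.2⟩‖

variable {W : H →ₗ[ℂ] H} {hW : M.IsBoundedOp W} {S : Submodule ℂ H} {hS : M.IsClosedSubspace S}

/-- Both compressions represent `[s, W t]` on `S`, and the identity of `S` is a homeomorphism
between the two topologies. -/
theorem exists_modulusSeminorm_le (D D' : FundamentalDecomposition M) (W : H →ₗ[ℂ] H)
    (hW : M.IsBoundedOp W) (S : Submodule ℂ H) (hS : M.IsClosedSubspace S) :
    ∃ k : ℝ, 0 ≤ k ∧ ∀ s : S,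
      D'.modulusSeminorm W hW S hS s ≤ k * D.modulusSeminorm W hW S hS s := by
  have := D.completeSpace_subspace hS
  have := D'.completeSpace_subspace hS
  obtain ⟨k, hk, h⟩ := exists_norm_modulusSqrt_le (D.subspaceEquiv D' S)
    (blockA (D.signatureMul W hW) (D.subspace S))
    (blockA (D'.signatureMul W hW) (D'.subspace S)) fun x y => by
      rw [inner_blockA, inner_blockA]
      exact (D.inner_signatureMul hW (D.toSpace.symm x) (D.toSpace.symm y)).trans
        (D'.inner_signatureMul hW (D.toSpace.symm x) (D.toSpace.symm y)).symm
  exact ⟨k, hk, fun s => h ⟨D.toSpace s, s.2⟩⟩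

/-- The seminorm is the only trace of `J` on the right-hand side. -/
theorem weaklyComplementable_iff (D : FundamentalDecomposition M)
    (hWsa : M.IsSelfAdjointOp W) :
    D.WeaklyComplementable W hW S hS ↔
      ∀ y : H, ∃ C : ℝ, ∀ s : S, ‖M.form s (W y)‖ ≤ C * D.modulusSeminorm W hW S hS s := by
  have := D.completeSpace_subspace hS
  refine (isWeaklyComplementable_iff (D.isSelfAdjoint_signatureMul hW hWsa)).trans
    (forall_congr' fun y => exists_congr fun C => forall_congr' fun s => ?_)
  rw [show inner ℂ (s : D.Space) (D.signatureMul W hW y) = M.form s.1 (W y) from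
    D.inner_signatureMul hW (D.toSpace.symm s) (D.toSpace.symm y)]
  rfl

theorem WeaklyComplementable.of_signature {D : FundamentalDecomposition M}
    (h : D.WeaklyComplementable W hW S hS) (hWsa : M.IsSelfAdjointOp W)
    (D' : FundamentalDecomposition M) : D'.WeaklyComplementable W hW S hS := by
  rw [weaklyComplementable_iff _ hWsa] at h ⊢
  obtain ⟨k, hk, hle⟩ := D'.exists_modulusSeminorm_le D W hW S hS
  intro y
  obtain ⟨C, hC⟩ := h y
  -- `C` may be negative, so `|C|` is needed before the seminorm is enlarged.
  refine ⟨|C| * k, fun s => (hC s).trans ?_⟩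
  have h0 : 0 ≤ D.modulusSeminorm W hW S hS s := norm_nonneg _
  calc C * D.modulusSeminorm W hW S hS s
      ≤ |C| * D.modulusSeminorm W hW S hS s := by gcongr; exact le_abs_self C
    _ ≤ |C| * (k * D'.modulusSeminorm W hW S hS s) := by gcongr; exact hle s
    _ = |C| * k * D'.modulusSeminorm W hW S hS s := by ring

/-- The `J` in front of the Schur complement cancels the one in the inner product, as `J² = 1`. -/
theorem form_schur (D : FundamentalDecomposition M) (h : D.WeaklyComplementable W hW S hS)
    (x y : H) :
    haveI := D.completeSpace_subspace hS
    M.form x (D.schur W hW S hS h y) = inner ℂ (D.toSpace x)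
      (schurComplement (D.signatureMul W hW) (D.subspace S) h (D.toSpace y)) := by
  rw [D.form_eq_inner]
  exact congrArg _ (D.signature_signature _)

theorem WeaklyComplementable.exists_norm_form_sub_le {D : FundamentalDecomposition M}
    (h : D.WeaklyComplementable W hW S hS) (hWsa : M.IsSelfAdjointOp W) (x : H)
    {ε : ℝ} (hε : 0 < ε) :
    ∃ s : S, ∀ t : S, ‖M.form (x - s) (W t)‖ ≤ ε * D.modulusSeminorm W hW S hS t := by
  have := D.completeSpace_subspace hS
  obtain ⟨s, hs⟩ := IsWeaklyComplementable.exists_norm_inner_sub_le h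
    (D.isSelfAdjoint_signatureMul hW hWsa) (D.toSpace x) hε
  refine ⟨⟨D.toSpace.symm s, s.2⟩, fun t => ?_⟩
  rw [← D.inner_signatureMul hW]
  exact hs ⟨D.toSpace t, t.2⟩

theorem WeaklyComplementable.exists_norm_form_sub_schur_le {D : FundamentalDecomposition M}
    (h : D.WeaklyComplementable W hW S hS) (hWsa : M.IsSelfAdjointOp W) (x y : H) :
    ∃ C : ℝ, ∀ ε : ℝ, 0 ≤ ε → ∀ s : S,
      (∀ t : S, ‖M.form (x - s) (W t)‖ ≤ ε * D.modulusSeminorm W hW S hS t) →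
        ‖M.form (x - s) (W y) - M.form x (D.schur W hW S hS h y)‖ ≤ ε * C := by
  have := D.completeSpace_subspace hS
  obtain ⟨C, hC⟩ := IsWeaklyComplementable.exists_norm_sub_schurComplement_le h
    (D.isSelfAdjoint_signatureMul hW hWsa) (D.toSpace x) (D.toSpace y)
  refine ⟨C, fun ε hε s hs => ?_⟩
  rw [form_schur, ← D.inner_signatureMul hW]
  refine hC ε hε ⟨D.toSpace s, s.2⟩ fun t => ?_
  refine (congrArg _ (D.inner_signatureMul hW (x - s) (D.toSpace.symm t))).trans_le ?_
  exact hs ⟨D.toSpace.symm t, t.2⟩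

theorem eq_of_form_eq (D : FundamentalDecomposition M) {v w : H}
    (h : ∀ x, M.form x v = M.form x w) : v = w := by
  refine D.toSpace.injective (ext_inner_left ℂ fun x => ?_)
  have h1 := h (D.signature (D.toSpace.symm x))
  rwa [← D.inner_toSpace, ← D.inner_toSpace, LinearEquiv.apply_symm_apply] at h1

theorem schur_eq_schur (D D' : FundamentalDecomposition M)
    (h : D.WeaklyComplementable W hW S hS) (h' : D'.WeaklyComplementable W hW S hS)
    (hWsa : M.IsSelfAdjointOp W) : D.schur W hW S hS h = D'.schur W hW S hS h' := by
  ext y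
  refine D.eq_of_form_eq fun x => ?_
  obtain ⟨k, hk, hle⟩ := D'.exists_modulusSeminorm_le D W hW S hS
  obtain ⟨C, hC⟩ := h.exists_norm_form_sub_schur_le hWsa x y
  obtain ⟨C', hC'⟩ := h'.exists_norm_form_sub_schur_le hWsa x y
  set p := M.form x (D.schur W hW S hS h y)
  set q := M.form x (D'.schur W hW S hS h' y)
  -- One `s`, chosen for `D` with `ε`, is admissible for `D'` with `ε k`; then `[x - s, W y]` is
  -- close to both `p` and `q`.
  have key (ε : ℝ) (hε : 0 < ε) : ‖p - q‖ ≤ ε * (C + k * C') := by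
    obtain ⟨s, hs⟩ := h.exists_norm_form_sub_le hWsa x hε
    have h1 := hC ε hε.le s hs
    have h2 := hC' (ε * k) (by positivity) s fun t => (hs t).trans <| by
      rw [mul_assoc]; gcongr; exact hle t
    have h3 := norm_sub_le (M.form (x - s) (W y) - q) (M.form (x - s) (W y) - p)
    rw [sub_sub_sub_cancel_left] at h3
    linarith
  have hlim : Filter.Tendsto (fun ε : ℝ => ε * (C + k * C')) (nhdsWithin 0 (Set.Ioi 0))
      (nhds 0) := by
    have : Continuous fun ε : ℝ => ε * (C + k * C') := by fun_prop
    simpa using (this.tendsto 0).mono_left nhdsWithin_le_nhds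
  have h0 : ‖p - q‖ ≤ 0 := ge_of_tendsto hlim (eventually_nhdsWithin_of_forall key)
  exact sub_eq_zero.mp (norm_le_zero_iff.mp h0)

end FundamentalDecomposition

theorem theorem4p6 {H : Type*} [AddCommGroup H] [Module ℂ H]
    (M : IndefiniteMetric H) (hM : M.IsKrein)
    (W : H →ₗ[ℂ] H) (hW : M.IsBoundedOp W) (hWsa : M.IsSelfAdjointOp W)
    (S : Submodule ℂ H) (hS : M.IsClosedSubspace S)
    (h : M.WeaklyComplementable W hW S hS) :
    (∀ D : FundamentalDecomposition M, D.WeaklyComplementable W hW S hS) ∧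
    (∀ (D Dα : FundamentalDecomposition M)
      (hD : D.WeaklyComplementable W hW S hS) (hDα : Dα.WeaklyComplementable W hW S hS),
      D.schur W hW S hS hD = Dα.schur W hW S hS hDα) ∧
    (∃! X : H →ₗ[ℂ] H, ∀ D : FundamentalDecomposition M,
      ∃ hD : D.WeaklyComplementable W hW S hS, D.schur W hW S hS hD = X) := by
  obtain ⟨D₀, h₀⟩ := h
  have hall (D : FundamentalDecomposition M) : D.WeaklyComplementable W hW S hS :=
    h₀.of_signature hWsa D
  refine ⟨hall, fun D Dα hD hDα => D.schur_eq_schur Dα hD hDα hWsa,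
    D₀.schur W hW S hS h₀, fun D => ⟨hall D, D.schur_eq_schur D₀ _ _ hWsa⟩, fun X hX => ?_⟩
  obtain ⟨_, rfl⟩ := hX D₀
  rfl
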